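/- **Setting.** Let $\Theta\subseteq\mathbb{R}^d$ be compact with $\ell_\infty$-diameter $D=\sup_{\theta_1,\theta_2\in\Theta}\|\theta_1-\theta_2\|_\infty$, let $(P_\theta)_{\theta\in\Theta}$ be a family of probability distributions on a measurable space $\mathcal{X}$, let $M:\Theta\times\Theta\to\mathbb{R}$ be a measurable loss, and let $n\ge 0$ be a sample size. Let $\mathcal{D}$ be the set of measurable functions $\hat\theta:\mathcal{X}^n\to\Theta$ (deterministic estimators). Let $R(\hat\theta,\theta)=\mathbb{E}_{\mathbb{X}^n\sim P_\theta^{\otimes n}}[M(\hat\theta(\mathbb{X}^n),\theta)]$, assumed to be a finite expectation for all $\hat\theta\in\mathcal{D}$, $\theta\in\Theta$, and $R(\hat\theta,P)=\mathbb{E}_{\theta\sim P}[R(\hat\theta,\theta)]$ for a probability measure $P$ on $\Theta$; for a randomized estimator (a probability measure on $\mathcal{D}$) the risk is averaged over the estimator as well. Suppose that for some $L\ge 0$, $|R(\hat\theta,\theta_1)-R(\hat\theta,\theta_2)|\le L\|\theta_1-\theta_2\|_1$ for all $\hat\theta\in\mathcal{D}$, $\theta_1,\theta_2\in\Theta$.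 **Oracles.** Let $\alpha,\beta,\alpha'\ge 0$. An $(\alpha,\beta)$-approximate maximization oracle maps every finite (possibly empty) family $\hat\theta_1,\dots,\hat\theta_k\in\mathcal{D}$ and every $\sigma\in\mathbb{R}^d$ to a point $\theta'\in\Theta$, measurably in $\sigma$, such that $$\sum_{i=1}^k R(\hat\theta_i,\theta')+\langle\sigma,\theta'\rangle\ \ge\ \sup_{\theta\in\Theta}\Big(\sum_{i=1}^k R(\hat\theta_i,\theta)+\langle\sigma,\theta\rangle\Big)-(\alpha+\beta\|\sigma\|_1).$$ An $\alpha'$-approximate minimization oracle maps every probability measure $P$ on $\Theta$ to some $\hat\theta'\in\mathcal{D}$ with $R(\hat\theta',P)\le\inf_{\hat\theta\in\mathcal{D}}R(\hat\theta,P)+\alpha'$. **Algorithm.** Given two such oracles, $\eta>0$ and $T\ge 1$, for $t=1,\dots,T$: let $P_t$ be the distribution of the output of the maximization oracle on $(\hat\theta_1,\dots,\hat\theta_{t-1})$ and $\sigma$, where $\sigma\in\mathbb{R}^d$ has i.i.d. exponential coordinates with parameter $\eta$ (that is, $\Pr(\sigma_j\ge s)=e^{-\eta s}$ for $s\ge0$);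 then let $\hat\theta_t$ be the output of the minimization oracle on $P_t$. **Theorem (Approximate NE).** Let $\hat\theta_{\mathrm{rnd}}$ be the randomized estimator that samples uniformly from $\hat\theta_1,\dots,\hat\theta_T$, and let $P_{\mathrm{avg}}=\frac1T\sum_{t=1}^T P_t$. Then $(\hat\theta_{\mathrm{rnd}},P_{\mathrm{avg}})$ is an $\varepsilon$-approximate mixed strategy Nash equilibrium: $$\sup_{\theta\in\Theta}R(\hat\theta_{\mathrm{rnd}},\theta)-\varepsilon\ \le\ R(\hat\theta_{\mathrm{rnd}},P_{\mathrm{avg}})\ \le\ \inf_{\hat\theta\in\mathcal{D}}R(\hat\theta,P_{\mathrm{avg}})+\varepsilon,$$ with finite supremum and infimum, where $$\varepsilon=C\Big(\eta d^2DL^2+\frac{d(\beta T+D)}{\eta T}+\alpha+\alpha'\Big)$$ and $C>0$ is an absolute constant. In particular $\varepsilon=O\big(\eta d^2+\frac{d(\beta T+D)}{\eta T}+\alpha+\alpha'\big)$, where the constant in $O(\cdot)$ depends only on $D$ and $L$. -/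

import Mathlib

open MeasureTheory ProbabilityTheory
open scoped ENNReal

universe u

/-- A statistical estimation problem with `n` independent samples in `𝒳`: a parameter set
`Θ ⊆ ℝ^d`, a family of probability distributions `P_θ` on `𝒳` indexed by `θ ∈ Θ`, and a
measurable loss `M : Θ × Θ → ℝ`, where `M θ' θ` is the cost of the estimate `θ'` when the true
parameter is `θ`. -/
structure StatisticalGame (d n : ℕ) (𝒳 : Type u) [MeasurableSpace 𝒳] where
  /-- the parameter set -/
  Θ : Set (Fin d → ℝ)
  /-- the distribution of one sample -/
  model : Θ → Measure 𝒳
  isProbabilityMeasure_model : ∀ θ, IsProbabilityMeasure (model θ)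
  /-- the loss -/
  loss : Θ → Θ → ℝ
  measurable_loss : Measurable (Function.uncurry loss)

namespace StatisticalGame

variable {d n : ℕ} {𝒳 : Type u} [MeasurableSpace 𝒳]

/-- The joint law of `n` independent samples from `P_θ`. -/
noncomputable def sampleLaw (G : StatisticalGame d n 𝒳) (θ : G.Θ) : Measure (Fin n → 𝒳) :=
  Measure.pi fun _ => G.model θ

/-- A deterministic estimator: a measurable function `𝒳^n → Θ`. -/
def Estimator (G : StatisticalGame d n 𝒳) : Type u :=
  {e : (Fin n → 𝒳) → G.Θ // Measurable e}

/-- A randomized estimator is a probability measure on the set of deterministic estimators.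
The only ones needed here are finitely supported, so that set carries the discrete
`σ`-algebra, for which every risk is a measurable function of the estimator. -/
instance (G : StatisticalGame d n 𝒳) : MeasurableSpace G.Estimator := ⊤

/-- The risk `R(e, θ) = E[M(e(X), θ)]`, with `X` distributed as `n` i.i.d. draws from `P_θ`. -/
noncomputable def risk (G : StatisticalGame d n 𝒳) (e : G.Estimator) (θ : G.Θ) : ℝ :=
  ∫ x, G.loss (e.1 x) θ ∂G.sampleLaw θ

/-- The integrated risk `R(e, P) = E_{θ ∼ P}[R(e, θ)]` under the prior `P`. -/
noncomputable def integratedRisk (G : StatisticalGame d n 𝒳) (e : G.Estimator)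
    (P : Measure G.Θ) : ℝ :=
  ∫ θ, G.risk e θ ∂P

/-- The risk `R(μ, θ)` of a randomized estimator `μ`. -/
noncomputable def riskRnd (G : StatisticalGame d n 𝒳) (μ : Measure G.Estimator) (θ : G.Θ) : ℝ :=
  ∫ e, G.risk e θ ∂μ

/-- The integrated risk `R(μ, P)` of a randomized estimator `μ`. -/
noncomputable def integratedRiskRnd (G : StatisticalGame d n 𝒳) (μ : Measure G.Estimator)
    (P : Measure G.Θ) : ℝ :=
  ∫ θ, G.riskRnd μ θ ∂P

/-- The risk is well defined: the loss of every deterministic estimator has a finite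
expectation at every parameter. -/
def HasFiniteRisk (G : StatisticalGame d n 𝒳) : Prop :=
  ∀ (e : G.Estimator) (θ : G.Θ), Integrable (fun x => G.loss (e.1 x) θ) (G.sampleLaw θ)

/-- The risk of every deterministic estimator is `L`-Lipschitz in the parameter with respect
to the `ℓ₁` norm. -/
def RiskLipschitz (G : StatisticalGame d n 𝒳) (L : ℝ) : Prop :=
  ∀ (e : G.Estimator) (θ₁ θ₂ : G.Θ),
    |G.risk e θ₁ - G.risk e θ₂| ≤ L * ∑ i, |θ₁.1 i - θ₂.1 i|

/-- An `(α, β)`-approximate maximization oracle: given a finite family `e₁, …, e_k` of estimators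
(possibly empty) and a perturbation `σ`, it returns a point of `Θ` which maximizes
`∑ i, R(e_i, θ) + ⟨σ, θ⟩` over `θ ∈ Θ` up to the error `α + β ‖σ‖₁`. Its output is a measurable
function of the perturbation, so that a random perturbation gives a random variable. -/
structure IsMaxOracle (G : StatisticalGame d n 𝒳) (α β : ℝ)
    (O : List G.Estimator → (Fin d → ℝ) → G.Θ) : Prop where
  measurable : ∀ es, Measurable (O es)
  approx_max : ∀ (es : List G.Estimator) (σ : Fin d → ℝ) (θ : G.Θ),
    (es.map fun e => G.risk e θ).sum + ∑ i, σ i * θ.1 i - (α + β * ∑ i, |σ i|) ≤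
      (es.map fun e => G.risk e (O es σ)).sum + ∑ i, σ i * (O es σ).1 i

/-- An `α'`-approximate minimization oracle: given a prior `P`, it returns an estimator which
minimizes the integrated risk `R(·, P)` over all deterministic estimators up to the error
`α'`. -/
def IsMinOracle (G : StatisticalGame d n 𝒳) (α' : ℝ) (O : Measure G.Θ → G.Estimator) : Prop :=
  ∀ (P : Measure G.Θ) [IsProbabilityMeasure P] (e : G.Estimator),
    G.integratedRisk (O P) P ≤ G.integratedRisk e P + α'

/-- The law of a random vector in `ℝ^d` with i.i.d. coordinates, each exponential with
parameter `η`, i.e. with `P(σ_j ≥ s) = exp (-η s)` for `s ≥ 0`. -/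
noncomputable def perturbationLaw (d : ℕ) (η : ℝ) : Measure (Fin d → ℝ) :=
  Measure.pi fun _ => expMeasure η

/-- The move of the maximization player after the estimators `es` were played: the law of
`maxO es σ` for an exponential perturbation `σ`. -/
noncomputable def ftplMove (G : StatisticalGame d n 𝒳) (η : ℝ)
    (maxO : List G.Estimator → (Fin d → ℝ) → G.Θ) (es : List G.Estimator) : Measure G.Θ :=
  (perturbationLaw d η).map (maxO es)

/-- The estimators played by the minimization player in the first `t` rounds of the algorithm,
in order: in each round the maximization player follows the perturbed leader, and the
minimization player then calls its oracle on that prior. -/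
noncomputable def history (G : StatisticalGame d n 𝒳) (η : ℝ)
    (maxO : List G.Estimator → (Fin d → ℝ) → G.Θ) (minO : Measure G.Θ → G.Estimator) :
    ℕ → List G.Estimator
  | 0 => []
  | t + 1 => G.history η maxO minO t ++ [minO (G.ftplMove η maxO (G.history η maxO minO t))]

/-- The prior chosen in round `t`, with rounds counted from `0`. -/
noncomputable def iterPrior (G : StatisticalGame d n 𝒳) (η : ℝ)
    (maxO : List G.Estimator → (Fin d → ℝ) → G.Θ) (minO : Measure G.Θ → G.Estimator)
    (t : ℕ) : Measure G.Θ :=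
  G.ftplMove η maxO (G.history η maxO minO t)

/-- The estimator chosen in round `t`, with rounds counted from `0`. -/
noncomputable def iterEstimator (G : StatisticalGame d n 𝒳) (η : ℝ)
    (maxO : List G.Estimator → (Fin d → ℝ) → G.Θ) (minO : Measure G.Θ → G.Estimator)
    (t : ℕ) : G.Estimator :=
  minO (G.iterPrior η maxO minO t)

/-- The randomized estimator that samples uniformly from the estimators of the first `T`
rounds. -/
noncomputable def rndEstimator (G : StatisticalGame d n 𝒳) (η : ℝ)
    (maxO : List G.Estimator → (Fin d → ℝ) → G.Θ) (minO : Measure G.Θ → G.Estimator)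
    (T : ℕ) : Measure G.Estimator :=
  (T : ℝ≥0∞)⁻¹ • ∑ t ∈ Finset.range T, Measure.dirac (G.iterEstimator η maxO minO t)

/-- The average of the priors of the first `T` rounds. -/
noncomputable def avgPrior (G : StatisticalGame d n 𝒳) (η : ℝ)
    (maxO : List G.Estimator → (Fin d → ℝ) → G.Θ) (minO : Measure G.Θ → G.Estimator)
    (T : ℕ) : Measure G.Θ :=
  (T : ℝ≥0∞)⁻¹ • ∑ t ∈ Finset.range T, G.iterPrior η maxO minO t

/-- `(μ, P)` is an `ε`-approximate mixed strategy Nash equilibrium: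
`sup_θ R(μ, θ) - ε ≤ R(μ, P) ≤ inf_e R(e, P) + ε`, where `μ` and `P` are probability measures
and the supremum and the infimum are finite. -/
structure IsApproxMixedNE (G : StatisticalGame d n 𝒳) (ε : ℝ) (μ : Measure G.Estimator)
    (P : Measure G.Θ) : Prop where
  isProbabilityMeasure_fst : IsProbabilityMeasure μ
  isProbabilityMeasure_snd : IsProbabilityMeasure P
  bddAbove : BddAbove (Set.range fun θ : G.Θ => G.riskRnd μ θ)
  sup_sub_le : (⨆ θ : G.Θ, G.riskRnd μ θ) - ε ≤ G.integratedRiskRnd μ P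
  bddBelow : BddBelow (Set.range fun e : G.Estimator => G.integratedRisk e P)
  le_inf_add : G.integratedRiskRnd μ P ≤ (⨅ e : G.Estimator, G.integratedRisk e P) + ε

end StatisticalGame

/-! The minimization player answers the current prior nearly optimally, so only the maximization
player's regret matters. Since the average risk is linear in the estimator and in the prior, a
regret bound per round gives the equilibrium (`isApproxMixedNE_of_regret_le`).

The regret has two sources. A leader who already sees the present round has none, up to oracle
errors and the size of the perturbation (`IsMaxOracle.be_the_leader`). The actual leader lags one
round behind, which costs at most `L` times the expected `ℓ₁` distance between consecutive leaders.

That distance is bounded in `integral_dist_perturbed_leader_le`. Raising `σ i` by `c` pushes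
coordinate `i` of both the old and the new leader above their former maximum, up to errors, so their
gap is at most the growth of their minimum. An exponential density changes by a factor at most `exp
(η * c)` under this shift, so the minimum grows on average by at most `η * c` times the diameter.
The errors contain the distance being bounded; a suitable `c` makes that contribution half of it,
and it is absorbed. -/

namespace ProbabilityTheory

/-! ### The exponential distribution on the line: shifts and mean. -/

lemma expMeasure_eq_withDensity (r : ℝ) :
    expMeasure r = volume.withDensity (exponentialPDF r) := rfl

lemma measurable_exponentialPDF (r : ℝ) : Measurable (exponentialPDF r) :=
  (measurable_exponentialPDFReal r).ennreal_ofReal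

lemma exponentialPDF_le_mul_add (r : ℝ) {c : ℝ} (hc : 0 ≤ c) (y : ℝ) :
    exponentialPDF r y ≤ ENNReal.ofReal (Real.exp (r * c)) * exponentialPDF r (y + c) := by
  rcases lt_or_ge y 0 with hy | hy
  · simp [exponentialPDF_of_neg hy]
  · rw [exponentialPDF_of_nonneg hy, exponentialPDF_of_nonneg (by positivity),
      ← ENNReal.ofReal_mul (by positivity)]
    refine ENNReal.ofReal_le_ofReal (le_of_eq ?_)
    rw [mul_left_comm, ← Real.exp_add]
    ring_nf

/-- Shifting an exponential variable to the right by `c` costs at most a factor `exp (r * c)`. -/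
lemma lintegral_comp_add_expMeasure_le (r : ℝ) {c : ℝ} (hc : 0 ≤ c) {h : ℝ → ℝ≥0∞}
    (hh : Measurable h) :
    ∫⁻ y, h (y + c) ∂expMeasure r ≤
      ENNReal.ofReal (Real.exp (r * c)) * ∫⁻ y, h y ∂expMeasure r := by
  rw [expMeasure_eq_withDensity,
    lintegral_withDensity_eq_lintegral_mul _ (measurable_exponentialPDF r) hh,
    lintegral_withDensity_eq_lintegral_mul _ (measurable_exponentialPDF r)
      (g := fun y => h (y + c)) (hh.comp (measurable_add_const c)),
    ← lintegral_add_right_eq_self (exponentialPDF r * h) c,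
    ← lintegral_const_mul' _ _ ENNReal.ofReal_ne_top]
  refine lintegral_mono fun y => ?_
  simp only [Pi.mul_apply]
  rw [← mul_assoc]
  gcongr
  exact exponentialPDF_le_mul_add r hc y

/-- Multiplying the exponential density by `y` gives `1 / r` times the Gamma density of shape 2 and
rate `r`, which has total mass one. -/
lemma lintegral_ofReal_abs_expMeasure {r : ℝ} (hr : 0 < r) :
    ∫⁻ y, ENNReal.ofReal |y| ∂expMeasure r = ENNReal.ofReal (1 / r) := by
  rw [expMeasure_eq_withDensity,
    lintegral_withDensity_eq_lintegral_mul _ (measurable_exponentialPDF r) (by fun_prop)]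
  have key : ∀ y : ℝ, (exponentialPDF r * fun y => ENNReal.ofReal |y|) y =
      ENNReal.ofReal (1 / r) * gammaPDF 2 r y := fun y => by
    rcases lt_or_ge y 0 with hy | hy
    · simp [exponentialPDF_of_neg hy, gammaPDF_of_neg hy]
    · rw [Pi.mul_apply, exponentialPDF_of_nonneg hy, gammaPDF_of_nonneg hy,
        ← ENNReal.ofReal_mul (by positivity), ← ENNReal.ofReal_mul (by positivity),
        abs_of_nonneg hy]
      congr 1
      have h2 : (2 : ℝ) - 1 = 1 := by norm_num
      rw [Real.Gamma_two, h2, Real.rpow_one, Real.rpow_two]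
      field_simp
  simp_rw [key]
  rw [lintegral_const_mul' _ _ ENNReal.ofReal_ne_top, lintegral_gammaPDF_eq_one two_pos hr, mul_one]

lemma integrable_abs_expMeasure {r : ℝ} (hr : 0 < r) :
    Integrable (fun y : ℝ => |y|) (expMeasure r) :=
  (lintegral_ofReal_ne_top_iff_integrable (by fun_prop) (ae_of_all _ fun y => abs_nonneg y)).1
    (by rw [lintegral_ofReal_abs_expMeasure hr]; exact ENNReal.ofReal_ne_top)

lemma integral_abs_expMeasure {r : ℝ} (hr : 0 < r) : ∫ y, |y| ∂expMeasure r = 1 / r := by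
  rw [integral_eq_lintegral_of_nonneg_ae (ae_of_all _ fun y => abs_nonneg y) (by fun_prop),
    lintegral_ofReal_abs_expMeasure hr, ENNReal.toReal_ofReal (by positivity)]

end ProbabilityTheory

/-! ### The exponential perturbation in `ℝ^d`. -/

namespace StatisticalGame

variable {d : ℕ} {η : ℝ}

lemma isProbabilityMeasure_perturbationLaw (hη : 0 < η) :
    IsProbabilityMeasure (perturbationLaw d η) := by
  have := isProbabilityMeasure_expMeasure hη
  unfold perturbationLaw
  infer_instance

lemma integrable_sum_abs_perturbationLaw (hη : 0 < η) :
    Integrable (fun σ : Fin d → ℝ => ∑ i, |σ i|) (perturbationLaw d η) := by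
  have := isProbabilityMeasure_expMeasure hη
  exact integrable_finsetSum _ fun i _ =>
    integrable_comp_eval (μ := fun _ : Fin d => expMeasure η) (i := i) (integrable_abs_expMeasure hη)

lemma integral_sum_abs_perturbationLaw (hη : 0 < η) :
    ∫ σ : Fin d → ℝ, ∑ i, |σ i| ∂perturbationLaw d η = d / η := by
  have := isProbabilityMeasure_expMeasure hη
  have hi : ∀ i : Fin d, ∫ σ : Fin d → ℝ, |σ i| ∂perturbationLaw d η = 1 / η := fun i => by
    have h := (measurePreserving_eval (fun _ : Fin d => expMeasure η) i).map_eq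
    rw [← integral_abs_expMeasure hη, ← h, integral_map (measurable_pi_apply i).aemeasurable (by fun_prop)]
    rfl
  unfold perturbationLaw at hi ⊢
  rw [integral_finsetSum _ fun i _ => integrable_comp_eval (μ := fun _ : Fin d => expMeasure η)
    (i := i) (integrable_abs_expMeasure hη)]
  simp only [hi, Finset.sum_const, Finset.card_univ, Fintype.card_fin, nsmul_eq_mul]
  ring

lemma lintegral_comp_add_single_perturbationLaw_le (hη : 0 < η) {c : ℝ} (hc : 0 ≤ c) (i : Fin d)
    {f : (Fin d → ℝ) → ℝ≥0∞} (hf : Measurable f) :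
    ∫⁻ σ, f (σ + Pi.single i c) ∂perturbationLaw d η ≤
      ENNReal.ofReal (Real.exp (η * c)) * ∫⁻ σ, f σ ∂perturbationLaw d η := by
  have := isProbabilityMeasure_expMeasure hη
  have hg : Measurable fun σ : Fin d → ℝ => f (σ + Pi.single i c) := hf.comp (by fun_prop)
  have hm : Measurable fun σ => ENNReal.ofReal (Real.exp (η * c)) * f σ := hf.const_mul _
  rw [← lintegral_const_mul' _ _ ENNReal.ofReal_ne_top]
  -- Integrating out coordinate `i` alone already gives the inequality, pointwise in the other
  -- coordinates; it survives integration over those.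
  have h := lmarginal_le_of_subset (μ := fun _ : Fin d => expMeasure η)
    (Finset.subset_univ {i}) hg hm (by
      intro x
      simp only [lmarginal_singleton]
      rw [lintegral_const_mul' _ _ ENNReal.ofReal_ne_top]
      have e : ∀ y, Function.update x i y + Pi.single i c = Function.update x i (y + c) := by
        intro y
        ext j
        by_cases hj : j = i
        · subst hj; simp
        · simp [hj]
      simp_rw [e]
      exact lintegral_comp_add_expMeasure_le η hc (h := fun y => f (Function.update x i y))
        (hf.comp (measurable_update x)))
  simp only [lmarginal_univ] at h
  exact h 0

/-- The expectation of a bounded function of an exponential perturbation grows by at most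
`η c` times its range when a coordinate of the perturbation is shifted by `c`. -/
lemma integral_comp_add_single_perturbationLaw_le (hη : 0 < η) {c : ℝ} (hc : 0 ≤ c) (i : Fin d)
    {f : (Fin d → ℝ) → ℝ} (hf : Measurable f) {a D : ℝ} (ha : ∀ σ, a ≤ f σ)
    (hD : ∀ σ, f σ ≤ a + D) :
    ∫ σ, f (σ + Pi.single i c) ∂perturbationLaw d η ≤
      ∫ σ, f σ ∂perturbationLaw d η + η * c * D := by
  have := isProbabilityMeasure_perturbationLaw (d := d) hη
  have hsh : Measurable fun σ : Fin d → ℝ => f (σ + Pi.single i c) := hf.comp (by fun_prop)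
  have hint : ∀ g : (Fin d → ℝ) → ℝ, Measurable g → (∀ σ, a ≤ g σ) → (∀ σ, g σ ≤ a + D) →
      Integrable g (perturbationLaw d η) := fun g hg h1 h2 =>
    Integrable.of_bound hg.aestronglyMeasurable (max |a| |a + D|)
      (ae_of_all _ fun σ => abs_le_max_abs_abs (h1 σ) (h2 σ))
  have I1 := hint f hf ha hD
  have I2 := hint _ hsh (fun σ => ha _) (fun σ => hD _)
  -- Subtracting the lower bound `a` makes the multiplicative estimate cost only the range of `f`,
  -- not its size.
  have hl := lintegral_comp_add_single_perturbationLaw_le hη hc i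
    (f := fun σ => ENNReal.ofReal (f σ - a)) (hf.sub_const a).ennreal_ofReal
  have I1' : Integrable (fun σ => f σ - a) (perturbationLaw d η) := I1.sub (integrable_const a)
  have I2' : Integrable (fun σ => f (σ + Pi.single i c) - a) (perturbationLaw d η) :=
    I2.sub (integrable_const a)
  rw [← ofReal_integral_eq_lintegral_ofReal I1' (ae_of_all _ fun σ => sub_nonneg.2 (ha σ)),
    ← ofReal_integral_eq_lintegral_ofReal I2' (ae_of_all _ fun σ => sub_nonneg.2 (ha _)),
    ← ENNReal.ofReal_mul (by positivity),
    ENNReal.ofReal_le_ofReal_iff (mul_nonneg (by positivity)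
      (integral_nonneg fun σ => sub_nonneg.2 (ha σ))),
    integral_sub I1 (integrable_const a), integral_sub I2 (integrable_const a)] at hl
  simp only [integral_const, probReal_univ, one_smul] at hl
  have hu : ∫ σ, f (σ + Pi.single i c) ∂perturbationLaw d η ≤ a + D := by
    simpa using integral_mono I2 (integrable_const (a + D)) fun σ => hD _
  have hlow : a ≤ ∫ σ, f (σ + Pi.single i c) ∂perturbationLaw d η := by
    simpa using integral_mono (integrable_const a) I2 fun σ => ha _
  -- Moving the exponential to the left and using `1 - η * c ≤ exp (-(η * c))` keeps the error
  -- linear in `η * c`, however large it is.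
  have he := mul_le_mul_of_nonneg_left hl (Real.exp_pos (-(η * c))).le
  rw [← mul_assoc, ← Real.exp_add, neg_add_cancel, Real.exp_zero, one_mul] at he
  have h1 := Real.add_one_le_exp (-(η * c))
  have hηc : 0 ≤ η * c := by positivity
  nlinarith [mul_le_mul_of_nonneg_right h1 (sub_nonneg.2 hlow),
    mul_le_mul_of_nonneg_left hu hηc]

end StatisticalGame

/-! ### Stability of the perturbed leader. -/

namespace StatisticalGame

variable {d : ℕ}

/-- If `x` and `y` maximize `F + ⟨σ, ·⟩` and `F + r + ⟨σ, ·⟩` up to the errors `γ`, and `x'`, `y'`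
do so up to the errors `γ + β c` after coordinate `i` of `σ` is raised by `c`, then coordinate `i`
of `x'` and of `y'` exceeds that of `x` and of `y`, up to the errors and the distance of `x`
and `y`. -/
lemma max_le_min_add_of_approx_max {Θ : Set (Fin d → ℝ)} {F r : Θ → ℝ} {L β γ c : ℝ}
    (hr : ∀ θ₁ θ₂, |r θ₁ - r θ₂| ≤ L * ∑ i, |θ₁.1 i - θ₂.1 i|) (hγ : 0 ≤ γ) (hL : 0 ≤ L)
    (hc : 0 < c) {σ : Fin d → ℝ} {i : Fin d} {x y x' y' : Θ}
    (hx : ∀ θ : Θ, F θ + ∑ j, σ j * θ.1 j - γ ≤ F x + ∑ j, σ j * x.1 j)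
    (hy : ∀ θ : Θ, F θ + r θ + ∑ j, σ j * θ.1 j - γ ≤ F y + r y + ∑ j, σ j * y.1 j)
    (hx' : ∀ θ : Θ, F θ + (∑ j, σ j * θ.1 j + c * θ.1 i) - (γ + β * c) ≤
      F x' + (∑ j, σ j * x'.1 j + c * x'.1 i))
    (hy' : ∀ θ : Θ, F θ + r θ + (∑ j, σ j * θ.1 j + c * θ.1 i) - (γ + β * c) ≤
      F y' + r y' + (∑ j, σ j * y'.1 j + c * y'.1 i)) :
    max (x.1 i) (y.1 i) ≤
      min (x'.1 i) (y'.1 i) + (L * ∑ j, |x.1 j - y.1 j| + 3 * γ) / c + β := by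
  have h0 : 0 ≤ L * ∑ j, |x.1 j - y.1 j| :=
    mul_nonneg hL (Finset.sum_nonneg fun _ _ => abs_nonneg _)
  obtain ⟨h1, h2⟩ := abs_le.1 (hr x y)
  have e : (L * ∑ j, |x.1 j - y.1 j| + 3 * γ) / c * c = L * ∑ j, |x.1 j - y.1 j| + 3 * γ :=
    div_mul_cancel₀ _ hc.ne'
  have key : ∀ a b : ℝ, c * a ≤ c * b + (L * ∑ j, |x.1 j - y.1 j| + 3 * γ) + β * c →
      a ≤ b + (L * ∑ j, |x.1 j - y.1 j| + 3 * γ) / c + β := fun a b h => by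
    refine le_of_mul_le_mul_left ?_ hc
    rw [← e] at h
    linarith
  -- With matching letters, two optimality inequalities suffice. In the mixed cases a detour, such
  -- as `x` to `y` to `y'`, uses three, and `r` enters only through `r x - r y`.
  rcases max_choice (x.1 i) (y.1 i) with hm | hm <;>
    rcases min_choice (x'.1 i) (y'.1 i) with hm' | hm' <;> rw [hm, hm'] <;> apply key
  · linarith [hx x', hx' x]
  · linarith [hx y, hy y', hy' x]
  · linarith [hy x, hx x', hx' y]
  · linarith [hy y', hy' y]

variable {Θ : Set (Fin d → ℝ)}

/-- The metric on `Fin d → ℝ` is the sup metric, so `Metric.diam` is the `ℓ∞` diameter. -/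
lemma abs_coord_sub_le_diam (hΘ : Bornology.IsBounded Θ) (θ₁ θ₂ : Θ) (i : Fin d) :
    |θ₁.1 i - θ₂.1 i| ≤ Metric.diam Θ := by
  rw [← Real.dist_eq]
  exact (dist_le_pi_dist θ₁.1 θ₂.1 i).trans (Metric.dist_le_diam_of_mem hΘ θ₁.2 θ₂.2)

lemma exists_forall_coord_mem_Icc (hΘ : Bornology.IsBounded Θ) (θ₀ : Θ) (i : Fin d) :
    ∃ a, ∀ θ : Θ, a ≤ θ.1 i ∧ θ.1 i ≤ a + Metric.diam Θ := by
  have : Nonempty Θ := ⟨θ₀⟩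
  have hb : BddBelow (Set.range fun θ : Θ => θ.1 i) :=
    ⟨θ₀.1 i - Metric.diam Θ, by
      rintro _ ⟨θ, rfl⟩
      linarith [(abs_le.1 (abs_coord_sub_le_diam hΘ θ θ₀ i)).1]⟩
  refine ⟨⨅ θ : Θ, θ.1 i, fun θ => ⟨ciInf_le hb θ, ?_⟩⟩
  rw [← sub_le_iff_le_add]
  exact le_ciInf fun θ' => by linarith [(abs_le.1 (abs_coord_sub_le_diam hΘ θ θ' i)).2]

lemma measurable_coord {X : (Fin d → ℝ) → Θ} (hX : Measurable X) (i : Fin d) :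
    Measurable fun σ => (X σ).1 i :=
  (measurable_pi_apply i).comp (measurable_subtype_coe.comp hX)

lemma integrable_abs_coord_sub {η : ℝ} (hη : 0 < η) (hΘ : Bornology.IsBounded Θ)
    {X Y : (Fin d → ℝ) → Θ} (hX : Measurable X) (hY : Measurable Y) (i : Fin d) :
    Integrable (fun σ => |(X σ).1 i - (Y σ).1 i|) (perturbationLaw d η) := by
  have := isProbabilityMeasure_perturbationLaw (d := d) hη
  exact Integrable.of_bound
    ((measurable_coord hX i).sub (measurable_coord hY i)).norm.aestronglyMeasurable (Metric.diam Θ)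
    (ae_of_all _ fun σ => by simpa using abs_coord_sub_le_diam hΘ (X σ) (Y σ) i)

/-- Stability of the approximate perturbed leader: adding an `L`-Lipschitz function `r` to the
objective moves it little in expectation. -/
lemma integral_dist_perturbed_leader_le {η : ℝ} (hη : 0 < η) (hΘ : Bornology.IsBounded Θ)
    {F r : Θ → ℝ} {L α β : ℝ} (hL : 0 < L) (hα : 0 ≤ α) (hβ : 0 ≤ β)
    (hr : ∀ θ₁ θ₂, |r θ₁ - r θ₂| ≤ L * ∑ i, |θ₁.1 i - θ₂.1 i|)
    {X Y : (Fin d → ℝ) → Θ} (hX : Measurable X) (hY : Measurable Y)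
    (hXmax : ∀ (σ : Fin d → ℝ) (θ : Θ), F θ + ∑ j, σ j * θ.1 j - (α + β * ∑ j, |σ j|) ≤
      F (X σ) + ∑ j, σ j * (X σ).1 j)
    (hYmax : ∀ (σ : Fin d → ℝ) (θ : Θ), F θ + r θ + ∑ j, σ j * θ.1 j - (α + β * ∑ j, |σ j|) ≤
      F (Y σ) + r (Y σ) + ∑ j, σ j * (Y σ).1 j) :
    L * ∫ σ, ∑ i, |(X σ).1 i - (Y σ).1 i| ∂perturbationLaw d η ≤
      4 * (η * d ^ 2 * Metric.diam Θ * L ^ 2) + 3 * (α + β * (d / η)) + 2 * (d * β * L) := by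
  have := isProbabilityMeasure_perturbationLaw (d := d) hη
  rcases Nat.eq_zero_or_pos d with rfl | hd
  · simp [hα]
  have hd' : (0 : ℝ) < d := by exact_mod_cast hd
  set P := perturbationLaw d η
  set S := ∫ σ, ∑ i, |(X σ).1 i - (Y σ).1 i| ∂P with hS
  -- Chosen so that `d * (L * S / c) = S / 2`, which can be absorbed on the left.
  set c := 2 * L * d with hc
  have hc0 : 0 < c := by positivity
  have hIabs : ∀ i, Integrable (fun σ => |(X σ).1 i - (Y σ).1 i|) P :=
    integrable_abs_coord_sub hη hΘ hX hY
  have hIsum : Integrable (fun σ => ∑ i, |(X σ).1 i - (Y σ).1 i|) P :=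
    integrable_finsetSum _ fun i _ => hIabs i
  have hIγ : Integrable (fun σ : Fin d → ℝ => α + β * ∑ j, |σ j|) P :=
    (integrable_const α).add ((integrable_sum_abs_perturbationLaw hη).const_mul β)
  have hEγ : ∫ σ : Fin d → ℝ, (α + β * ∑ j, |σ j|) ∂P = α + β * (d / η) := by
    rw [integral_add (integrable_const α) ((integrable_sum_abs_perturbationLaw hη).const_mul β),
      integral_const_mul, integral_sum_abs_perturbationLaw hη]
    simp
  have hcoord : ∀ i, ∫ σ, |(X σ).1 i - (Y σ).1 i| ∂P ≤
      η * c * Metric.diam Θ + (L * S + 3 * (α + β * (d / η))) / c + β := by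
    intro i
    obtain ⟨a, ha⟩ := exists_forall_coord_mem_Icc hΘ (X 0) i
    have hmin : Measurable fun σ => min ((X σ).1 i) ((Y σ).1 i) :=
      (measurable_coord hX i).min (measurable_coord hY i)
    have hbd : ∀ f : (Fin d → ℝ) → ℝ, Measurable f → (∀ σ, a ≤ f σ ∧ f σ ≤ a + Metric.diam Θ) →
        Integrable f P := fun f hf h =>
      Integrable.of_bound hf.aestronglyMeasurable (max |a| |a + Metric.diam Θ|)
        (ae_of_all _ fun σ => abs_le_max_abs_abs (h σ).1 (h σ).2)
    have hminb : ∀ σ, a ≤ min ((X σ).1 i) ((Y σ).1 i) ∧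
        min ((X σ).1 i) ((Y σ).1 i) ≤ a + Metric.diam Θ := fun σ =>
      ⟨le_min (ha _).1 (ha _).1, (min_le_left _ _).trans (ha _).2⟩
    have hI1 := hbd _ hmin hminb
    have hI2 := hbd (fun σ => min ((X (σ + Pi.single i c)).1 i) ((Y (σ + Pi.single i c)).1 i))
      (hmin.comp (by fun_prop)) fun σ => hminb _
    have hshift := integral_comp_add_single_perturbationLaw_le hη hc0.le i hmin
      (fun σ => (hminb σ).1) fun σ => (hminb σ).2
    -- The gap is maximum minus minimum, and the maximum is controlled by the shifted minimum.
    have hpt : ∀ σ, |(X σ).1 i - (Y σ).1 i| ≤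
        (min ((X (σ + Pi.single i c)).1 i) ((Y (σ + Pi.single i c)).1 i) -
          min ((X σ).1 i) ((Y σ).1 i)) +
        ((L * ∑ j, |(X σ).1 j - (Y σ).1 j| + 3 * (α + β * ∑ j, |σ j|)) / c + β) := by
      intro σ
      have hsum : ∀ θ : Θ, ∑ j, (σ + Pi.single i c : Fin d → ℝ) j * θ.1 j =
          ∑ j, σ j * θ.1 j + c * θ.1 i := fun θ => by
        simp [add_mul, Finset.sum_add_distrib, Pi.single_apply]
      have habs : ∑ j, |(σ + Pi.single i c : Fin d → ℝ) j| ≤ ∑ j, |σ j| + c := by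
        calc ∑ j, |(σ + Pi.single i c : Fin d → ℝ) j| ≤ ∑ j, (|σ j| + |(Pi.single i c : Fin d → ℝ) j|) :=
              Finset.sum_le_sum fun j _ => abs_add_le _ _
          _ = ∑ j, |σ j| + c := by
              rw [Finset.sum_add_distrib]
              congr 1
              rw [Finset.sum_eq_single i (fun j _ hj => by simp [hj]) (by simp)]
              simp [abs_of_pos hc0]
      have hβabs := mul_le_mul_of_nonneg_left habs hβ
      have h := max_le_min_add_of_approx_max (β := β) (γ := α + β * ∑ j, |σ j|) (c := c) (i := i)
        (x' := X (σ + Pi.single i c)) (y' := Y (σ + Pi.single i c)) hr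
        (add_nonneg hα (mul_nonneg hβ (Finset.sum_nonneg fun _ _ => abs_nonneg _))) hL.le hc0
        (hXmax σ) (hYmax σ)
        (fun θ => by
          have := hXmax (σ + Pi.single i c) θ
          rw [hsum, hsum] at this
          linarith)
        (fun θ => by
          have := hYmax (σ + Pi.single i c) θ
          rw [hsum, hsum] at this
          linarith)
      have hmm := max_sub_min_eq_abs ((X σ).1 i) ((Y σ).1 i)
      rw [abs_sub_comm] at hmm
      linarith
    have hIE : Integrable (fun σ : Fin d → ℝ =>
        L * ∑ j, |(X σ).1 j - (Y σ).1 j| + 3 * (α + β * ∑ j, |σ j|)) P :=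
      (hIsum.const_mul L).add (hIγ.const_mul 3)
    have hId : Integrable (fun σ =>
        min ((X (σ + Pi.single i c)).1 i) ((Y (σ + Pi.single i c)).1 i) -
          min ((X σ).1 i) ((Y σ).1 i)) P := hI2.sub hI1
    have hIe : Integrable (fun σ : Fin d → ℝ =>
        (L * ∑ j, |(X σ).1 j - (Y σ).1 j| + 3 * (α + β * ∑ j, |σ j|)) / c + β) P :=
      (hIE.div_const c).add (integrable_const β)
    have h := integral_mono (hIabs i) (hId.add hIe) hpt
    simp only [Pi.add_apply] at h
    rw [integral_add hId hIe,
      integral_sub hI2 hI1, integral_add (hIE.div_const c) (integrable_const β),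
      integral_div, integral_add (hIsum.const_mul L) (hIγ.const_mul 3), integral_const_mul,
      integral_const_mul, hEγ, ← hS] at h
    simp only [integral_const, probReal_univ, one_smul] at h
    linarith
  have hSle : S ≤ d * (η * c * Metric.diam Θ + (L * S + 3 * (α + β * (d / η))) / c + β) := by
    calc S = ∑ i, ∫ σ, |(X σ).1 i - (Y σ).1 i| ∂P := integral_finsetSum _ fun i _ => hIabs i
      _ ≤ ∑ _i : Fin d, _ := Finset.sum_le_sum fun i _ => hcoord i
      _ = _ := by rw [Finset.sum_const, Finset.card_univ, Fintype.card_fin, nsmul_eq_mul]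
  have e : d * (η * c * Metric.diam Θ + (L * S + 3 * (α + β * (d / η))) / c + β) * (2 * L) =
      4 * (η * d ^ 2 * Metric.diam Θ * L ^ 2) + L * S + 3 * (α + β * (d / η)) +
        2 * (d * β * L) := by
    rw [hc]
    field_simp
    ring
  have := mul_le_mul_of_nonneg_right hSle (by positivity : 0 ≤ 2 * L)
  rw [e] at this
  linarith

/-- The stability estimate with the error term of the theorem. -/
lemma integral_sub_perturbed_leader_le {η : ℝ} (hη : 0 < η) (hΘ : Bornology.IsBounded Θ)
    {F r : Θ → ℝ} {L α β : ℝ} (hL : 0 ≤ L) (hα : 0 ≤ α) (hβ : 0 ≤ β)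
    (hr : ∀ θ₁ θ₂, |r θ₁ - r θ₂| ≤ L * ∑ i, |θ₁.1 i - θ₂.1 i|)
    {X Y : (Fin d → ℝ) → Θ} (hX : Measurable X) (hY : Measurable Y)
    (hXmax : ∀ (σ : Fin d → ℝ) (θ : Θ), F θ + ∑ j, σ j * θ.1 j - (α + β * ∑ j, |σ j|) ≤
      F (X σ) + ∑ j, σ j * (X σ).1 j)
    (hYmax : ∀ (σ : Fin d → ℝ) (θ : Θ), F θ + r θ + ∑ j, σ j * θ.1 j - (α + β * ∑ j, |σ j|) ≤
      F (Y σ) + r (Y σ) + ∑ j, σ j * (Y σ).1 j) :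
    L * ∫ σ, ∑ i, |(X σ).1 i - (Y σ).1 i| ∂perturbationLaw d η ≤
      4 * (η * d ^ 2 * Metric.diam Θ * L ^ 2) + 3 * α + 5 * (d * β / η) := by
  have := isProbabilityMeasure_perturbationLaw (d := d) hη
  have hD : 0 ≤ Metric.diam Θ := Metric.diam_nonneg
  rcases hL.eq_or_lt with rfl | hL0
  · rw [zero_mul]; positivity
  -- If `η * L ≤ 1`, the stray term `d * β * L` is at most `d * β / η`. Otherwise the trivial
  -- diameter bound is already below the `L ^ 2` term.
  rcases le_or_gt (η * L) 1 with h | h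
  · have h1 := integral_dist_perturbed_leader_le hη hΘ hL0 hα hβ hr hX hY hXmax hYmax
    have h2 : d * β * L ≤ d * β / η := by
      rw [le_div_iff₀ hη]
      have := mul_le_mul_of_nonneg_left h (by positivity : 0 ≤ d * β)
      linarith
    have e : β * (d / η) = d * β / η := by ring
    rw [e] at h1
    linarith
  · have h1 : ∫ σ, ∑ i, |(X σ).1 i - (Y σ).1 i| ∂perturbationLaw d η ≤ d * Metric.diam Θ := by
      have h := integral_mono (μ := perturbationLaw d η)
        (integrable_finsetSum Finset.univ fun i _ => integrable_abs_coord_sub hη hΘ hX hY i)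
        (integrable_const (d * Metric.diam Θ)) fun σ =>
          (Finset.sum_le_sum fun i _ => abs_coord_sub_le_diam hΘ (X σ) (Y σ) i).trans
            (by simp)
      simpa using h
    have hd : (d : ℝ) ≤ d ^ 2 := by exact_mod_cast Nat.le_self_pow two_ne_zero d
    calc _ ≤ L * (d * Metric.diam Θ) := by gcongr
      _ ≤ L * (d ^ 2 * Metric.diam Θ) * (η * L) := by
        have : L * (d * Metric.diam Θ) ≤ L * (d ^ 2 * Metric.diam Θ) := by gcongr
        exact this.trans (le_mul_of_one_le_right (by positivity) h.le)
      _ = η * d ^ 2 * Metric.diam Θ * L ^ 2 := by ring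
      _ ≤ _ := by
        have h1 : 0 ≤ η * d ^ 2 * Metric.diam Θ * L ^ 2 := by positivity
        have h2 : 0 ≤ d * β / η := by positivity
        linarith

end StatisticalGame

/-! ### Averages over rounds, and the regret of the maximization player. -/

namespace StatisticalGame

lemma isProbabilityMeasure_inv_smul_sum {Ω : Type*} [MeasurableSpace Ω] {T : ℕ} (hT : 1 ≤ T)
    (μ : ℕ → Measure Ω) [∀ t, IsProbabilityMeasure (μ t)] :
    IsProbabilityMeasure ((T : ℝ≥0∞)⁻¹ • ∑ t ∈ Finset.range T, μ t) := by
  constructor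
  have hT0 : (T : ℝ≥0∞) ≠ 0 := by
    simp only [ne_eq, Nat.cast_eq_zero]
    omega
  simp [ENNReal.inv_mul_cancel hT0 (ENNReal.natCast_ne_top T)]

lemma integral_inv_smul_sum {Ω : Type*} [MeasurableSpace Ω] (T : ℕ)
    (μ : ℕ → Measure Ω) {f : Ω → ℝ} (hf : ∀ t, Integrable f (μ t)) :
    ∫ x, f x ∂((T : ℝ≥0∞)⁻¹ • ∑ t ∈ Finset.range T, μ t) =
      (∑ t ∈ Finset.range T, ∫ x, f x ∂μ t) / T := by
  rw [integral_smul_measure, integral_finsetSum_measure fun t _ => hf t]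
  simp [div_eq_inv_mul]

variable {d n : ℕ} {𝒳 : Type u} [MeasurableSpace 𝒳] {G : StatisticalGame d n 𝒳}

lemma RiskLipschitz.continuous_risk {L : ℝ} (hG : G.RiskLipschitz L) (e : G.Estimator) :
    Continuous (G.risk e) := by
  refine continuous_iff_continuousAt.2 fun θ₀ => ?_
  rw [ContinuousAt, tendsto_iff_dist_tendsto_zero]
  have h : Filter.Tendsto (fun θ : G.Θ => L * ∑ i, |θ.1 i - θ₀.1 i|) (nhds θ₀) (nhds 0) := by
    have hc : Continuous fun θ : G.Θ => L * ∑ i, |θ.1 i - θ₀.1 i| :=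
      continuous_const.mul (continuous_finsetSum _ fun i _ =>
        (((continuous_apply i).comp continuous_subtype_val).sub continuous_const).abs)
    simpa using hc.tendsto θ₀
  exact squeeze_zero (fun _ => dist_nonneg) (fun θ => hG e θ θ₀) h

/-- Continuity supplies measurability of the risk in the parameter, and compactness supplies
boundedness. -/
lemma RiskLipschitz.integrable_risk {L : ℝ} (hG : G.RiskLipschitz L) (hΘ : IsCompact G.Θ)
    (e : G.Estimator) (P : Measure G.Θ) [IsFiniteMeasure P] : Integrable (G.risk e) P := by
  have : CompactSpace G.Θ := isCompact_iff_compactSpace.1 hΘ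
  have hc := hG.continuous_risk e
  obtain ⟨K, hK⟩ := (isCompact_range hc).isBounded.exists_norm_le
  exact Integrable.of_bound hc.measurable.aestronglyMeasurable K
    (ae_of_all _ fun θ => hK _ ⟨θ, rfl⟩)

section Iterates

variable {η : ℝ} {maxO : List G.Estimator → (Fin d → ℝ) → G.Θ} {minO : Measure G.Θ → G.Estimator}

lemma sum_map_history_succ (t : ℕ) (θ : G.Θ) :
    ((G.history η maxO minO (t + 1)).map fun e => G.risk e θ).sum =
      ((G.history η maxO minO t).map fun e => G.risk e θ).sum +
        G.risk (G.iterEstimator η maxO minO t) θ := by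
  simp [history, iterEstimator, iterPrior]

lemma sum_map_history (T : ℕ) (θ : G.Θ) :
    ((G.history η maxO minO T).map fun e => G.risk e θ).sum =
      ∑ t ∈ Finset.range T, G.risk (G.iterEstimator η maxO minO t) θ := by
  induction T with
  | zero => simp [history]
  | succ T ih => rw [sum_map_history_succ, Finset.sum_range_succ, ih]

lemma IsMaxOracle.isProbabilityMeasure_iterPrior {α β : ℝ} (hO : G.IsMaxOracle α β maxO)
    (hη : 0 < η) (t : ℕ) : IsProbabilityMeasure (G.iterPrior η maxO minO t) := by
  have := isProbabilityMeasure_perturbationLaw (d := d) hη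
  exact Measure.isProbabilityMeasure_map (hO.measurable _).aemeasurable

/-- Be the leader: playing the response to the history that includes the present round has no
regret up to the perturbation and the errors of the oracle. -/
lemma IsMaxOracle.be_the_leader {α β : ℝ} (hO : G.IsMaxOracle α β maxO) (T : ℕ)
    (σ : Fin d → ℝ) (θ : G.Θ) :
    ∑ t ∈ Finset.range T, G.risk (G.iterEstimator η maxO minO t) θ + ∑ i, σ i * θ.1 i ≤
      ∑ t ∈ Finset.range T, G.risk (G.iterEstimator η maxO minO t)
          (maxO (G.history η maxO minO (t + 1)) σ) +
        ∑ i, σ i * (maxO [] σ).1 i + (T + 1) * (α + β * ∑ i, |σ i|) := by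
  induction T generalizing θ with
  | zero =>
    have := hO.approx_max [] σ θ
    simp only [List.map_nil, List.sum_nil] at this
    simp
    linarith
  | succ T ih =>
    have h := hO.approx_max (G.history η maxO minO (T + 1)) σ θ
    rw [sum_map_history, sum_map_history] at h
    -- The induction hypothesis is used against the newest leader as competitor, hence the
    -- generalization over `θ`. The empty history accounts for the extra oracle error in `T + 1`.
    have h' := ih (maxO (G.history η maxO minO (T + 1)) σ)
    rw [Finset.sum_range_succ, Finset.sum_range_succ] at h
    rw [Finset.sum_range_succ, Finset.sum_range_succ]
    push_cast
    linarith

/-- The regret of the maximization player over `T` rounds. -/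
lemma IsMaxOracle.sum_risk_le {α β L : ℝ} (hO : G.IsMaxOracle α β maxO) (hη : 0 < η)
    (hΘ : IsCompact G.Θ) (hL : 0 ≤ L) (hG : G.RiskLipschitz L) (hα : 0 ≤ α) (hβ : 0 ≤ β)
    (T : ℕ) (θ : G.Θ) :
    ∑ t ∈ Finset.range T, G.risk (G.iterEstimator η maxO minO t) θ ≤
      ∑ t ∈ Finset.range T,
          G.integratedRisk (G.iterEstimator η maxO minO t) (G.iterPrior η maxO minO t) +
        Metric.diam G.Θ * (d / η) + (T + 1) * (α + β * (d / η)) +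
        T * (4 * (η * d ^ 2 * Metric.diam G.Θ * L ^ 2) + 3 * α + 5 * (d * β / η)) := by
  have := isProbabilityMeasure_perturbationLaw (d := d) hη
  set P := perturbationLaw d η with hP
  -- One `σ` drives all rounds. This coupling is harmless, because the integrated risks depend only
  -- on the law of each `X t`.
  set X : ℕ → (Fin d → ℝ) → G.Θ := fun t => maxO (G.history η maxO minO t) with hX
  have hXm : ∀ t, Measurable (X t) := fun t => hO.measurable _
  set r : ℕ → G.Θ → ℝ := fun t => G.risk (G.iterEstimator η maxO minO t) with hr
  have hprior : ∀ t, G.iterPrior η maxO minO t = P.map (X t) := fun t => rfl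
  have hIr : ∀ t, Integrable (fun σ => r t (X t σ)) P := fun t => by
    have := hO.isProbabilityMeasure_iterPrior (minO := minO) hη t
    exact (hG.integrable_risk hΘ _ (G.iterPrior η maxO minO t)).comp_measurable (hXm t)
  have hEr : ∀ t, ∫ σ, r t (X t σ) ∂P =
      G.integratedRisk (G.iterEstimator η maxO minO t) (G.iterPrior η maxO minO t) := fun t => by
    rw [integratedRisk, hprior, integral_map (hXm t).aemeasurable
      (hG.continuous_risk _).measurable.aestronglyMeasurable]
  have hIn := integrable_sum_abs_perturbationLaw (d := d) hη
  have hEn := integral_sum_abs_perturbationLaw (d := d) hη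
  rw [← hP] at hIn hEn
  have hIγ : Integrable (fun σ : Fin d → ℝ => α + β * ∑ j, |σ j|) P :=
    (integrable_const α).add (hIn.const_mul β)
  have hEγ : ∫ σ : Fin d → ℝ, (α + β * ∑ j, |σ j|) ∂P = α + β * (d / η) := by
    rw [integral_add (integrable_const α) (hIn.const_mul β), integral_const_mul, hEn]
    simp
  have hIs : ∀ t, Integrable (fun σ => ∑ i, |(X t σ).1 i - (X (t + 1) σ).1 i|) P := fun t =>
    integrable_finsetSum _ fun i _ =>
      integrable_abs_coord_sub hη hΘ.isBounded (hXm t) (hXm (t + 1)) i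
  have hEs : ∀ t, L * ∫ σ, ∑ i, |(X t σ).1 i - (X (t + 1) σ).1 i| ∂P ≤
      4 * (η * d ^ 2 * Metric.diam G.Θ * L ^ 2) + 3 * α + 5 * (d * β / η) := fun t =>
    integral_sub_perturbed_leader_le hη hΘ.isBounded
      (F := fun θ => ((G.history η maxO minO t).map fun e => G.risk e θ).sum) (r := r t)
      hL hα hβ (hG _) (hXm t) (hXm (t + 1)) (hO.approx_max _) fun σ θ => by
        have := hO.approx_max (G.history η maxO minO (t + 1)) σ θ
        rwa [sum_map_history_succ, sum_map_history_succ] at this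
  have hpt : ∀ σ : Fin d → ℝ, ∑ t ∈ Finset.range T, r t θ ≤
      (∑ t ∈ Finset.range T,
        (r t (X t σ) + L * ∑ i, |(X t σ).1 i - (X (t + 1) σ).1 i|)) +
      (Metric.diam G.Θ * ∑ j, |σ j| + (T + 1) * (α + β * ∑ j, |σ j|)) := by
    intro σ
    have h1 := hO.be_the_leader (η := η) (minO := minO) T σ θ
    have h2 : ∑ t ∈ Finset.range T, r t (X (t + 1) σ) ≤ ∑ t ∈ Finset.range T,
        (r t (X t σ) + L * ∑ i, |(X t σ).1 i - (X (t + 1) σ).1 i|) :=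
      Finset.sum_le_sum fun t _ => by
        linarith [(abs_le.1 (hG (G.iterEstimator η maxO minO t) (X t σ) (X (t + 1) σ))).1]
    have h3 : ∑ i, σ i * (maxO [] σ).1 i - ∑ i, σ i * θ.1 i ≤
        Metric.diam G.Θ * ∑ j, |σ j| := by
      rw [← Finset.sum_sub_distrib, Finset.mul_sum]
      refine Finset.sum_le_sum fun i _ => ?_
      rw [← mul_sub, mul_comm (Metric.diam G.Θ)]
      refine (le_abs_self _).trans ?_
      rw [abs_mul]
      gcongr
      exact abs_coord_sub_le_diam hΘ.isBounded _ _ _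
    linarith
  have hIt : ∀ t, Integrable (fun σ =>
      r t (X t σ) + L * ∑ i, |(X t σ).1 i - (X (t + 1) σ).1 i|) P := fun t =>
    (hIr t).add ((hIs t).const_mul L)
  have hI1 : Integrable (fun σ => ∑ t ∈ Finset.range T,
      (r t (X t σ) + L * ∑ i, |(X t σ).1 i - (X (t + 1) σ).1 i|)) P :=
    integrable_finsetSum _ fun t _ => hIt t
  have hI2 : Integrable (fun σ : Fin d → ℝ => Metric.diam G.Θ * ∑ j, |σ j| +
      (T + 1) * (α + β * ∑ j, |σ j|)) P :=
    (hIn.const_mul _).add (hIγ.const_mul _)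
  have h := integral_mono (integrable_const (μ := P) _) (hI1.add hI2) hpt
  simp only [Pi.add_apply] at h
  rw [integral_add hI1 hI2,
    integral_finsetSum _ fun t _ => hIt t,
    integral_add (hIn.const_mul _) (hIγ.const_mul _), integral_const_mul, integral_const_mul,
    hEn, hEγ] at h
  simp only [integral_const, probReal_univ, one_smul] at h
  have hsum : ∑ t ∈ Finset.range T, ∫ σ, (r t (X t σ) +
      L * ∑ i, |(X t σ).1 i - (X (t + 1) σ).1 i|) ∂P ≤
      ∑ t ∈ Finset.range T,
        (G.integratedRisk (G.iterEstimator η maxO minO t) (G.iterPrior η maxO minO t) +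
        (4 * (η * d ^ 2 * Metric.diam G.Θ * L ^ 2) + 3 * α + 5 * (d * β / η))) :=
    Finset.sum_le_sum fun t _ => by
      rw [integral_add (hIr t) ((hIs t).const_mul L), integral_const_mul, hEr]
      linarith [hEs t]
  rw [Finset.sum_add_distrib, Finset.sum_const, Finset.card_range, nsmul_eq_mul] at hsum
  linarith

/-! ### From regret to equilibrium. -/

lemma riskRnd_rndEstimator (T : ℕ) (θ : G.Θ) :
    G.riskRnd (G.rndEstimator η maxO minO T) θ =
      (∑ t ∈ Finset.range T, G.risk (G.iterEstimator η maxO minO t) θ) / T := by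
  have hm : Measurable fun e : G.Estimator => G.risk e θ := measurable_from_top
  rw [riskRnd, rndEstimator, integral_inv_smul_sum T _ fun t =>
    (integrable_dirac' hm.stronglyMeasurable (by simp))]
  simp only [integral_dirac' _ _ hm.stronglyMeasurable]

lemma integratedRisk_avgPrior {α β L : ℝ} (hO : G.IsMaxOracle α β maxO) (hη : 0 < η)
    (hΘ : IsCompact G.Θ) (hG : G.RiskLipschitz L) (T : ℕ) (e : G.Estimator) :
    G.integratedRisk e (G.avgPrior η maxO minO T) =
      (∑ t ∈ Finset.range T, G.integratedRisk e (G.iterPrior η maxO minO t)) / T := by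
  have := hO.isProbabilityMeasure_iterPrior (minO := minO) hη
  exact integral_inv_smul_sum T _ fun t => hG.integrable_risk hΘ e _

lemma isProbabilityMeasure_avgPrior {α β : ℝ} (hO : G.IsMaxOracle α β maxO) (hη : 0 < η)
    {T : ℕ} (hT : 1 ≤ T) : IsProbabilityMeasure (G.avgPrior η maxO minO T) := by
  have := hO.isProbabilityMeasure_iterPrior (minO := minO) hη
  exact isProbabilityMeasure_inv_smul_sum hT _

/-- A bound `ρ` on the regret of the maximization player gives an approximate equilibrium. -/
lemma isApproxMixedNE_of_regret_le {α β α' L ρ : ℝ} (hO : G.IsMaxOracle α β maxO) (hη : 0 < η)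
    (hΘ : IsCompact G.Θ) (hG : G.RiskLipschitz L) (hmin : G.IsMinOracle α' minO)
    {T : ℕ} (hT : 1 ≤ T)
    (hρ : ∀ θ, (∑ t ∈ Finset.range T, G.risk (G.iterEstimator η maxO minO t) θ) / T ≤
      (∑ t ∈ Finset.range T,
        G.integratedRisk (G.iterEstimator η maxO minO t) (G.iterPrior η maxO minO t)) / T + ρ) :
    G.IsApproxMixedNE (ρ + α') (G.rndEstimator η maxO minO T) (G.avgPrior η maxO minO T) := by
  have hT0 : (0 : ℝ) < T := by exact_mod_cast hT
  have := isProbabilityMeasure_avgPrior (minO := minO) hO hη hT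
  have := hO.isProbabilityMeasure_iterPrior (minO := minO) hη
  set P := G.avgPrior η maxO minO T with hP
  -- `A` is the pivot: every `R(μ, θ)` is at most `A + ρ` by the regret bound, and every `R(e, P)`
  -- is at least `A - α'` by the minimization oracle. Averaging puts `R(μ, P)` between the two.
  set A := (∑ t ∈ Finset.range T,
    G.integratedRisk (G.iterEstimator η maxO minO t) (G.iterPrior η maxO minO t)) / T with hA
  have : Nonempty G.Θ := ⟨maxO [] 0⟩
  have : Nonempty G.Estimator := ⟨minO P⟩
  have hsup : ∀ θ, G.riskRnd (G.rndEstimator η maxO minO T) θ ≤ A + ρ := fun θ => by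
    rw [riskRnd_rndEstimator]
    exact hρ θ
  have hinf : ∀ e, A - α' ≤ G.integratedRisk e P := fun e => by
    rw [hP, integratedRisk_avgPrior hO hη hΘ hG, hA, sub_le_iff_le_add, div_add' _ _ _ hT0.ne']
    gcongr
    calc _ ≤ ∑ t ∈ Finset.range T, (G.integratedRisk e (G.iterPrior η maxO minO t) + α') :=
          Finset.sum_le_sum fun t _ => hmin _ e
      _ = _ := by
          rw [Finset.sum_add_distrib, Finset.sum_const, Finset.card_range, nsmul_eq_mul]
          ring
  have hI : ∀ t, Integrable (G.risk (G.iterEstimator η maxO minO t)) P := fun t =>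
    hG.integrable_risk hΘ _ _
  have hfun : G.riskRnd (G.rndEstimator η maxO minO T) = fun θ =>
      (∑ t ∈ Finset.range T, G.risk (G.iterEstimator η maxO minO t) θ) / T :=
    funext fun θ => riskRnd_rndEstimator T θ
  have hIrnd : Integrable (G.riskRnd (G.rndEstimator η maxO minO T)) P := by
    rw [hfun]
    exact (integrable_finsetSum _ fun t _ => hI t).div_const _
  have hval : G.integratedRiskRnd (G.rndEstimator η maxO minO T) P =
      (∑ t ∈ Finset.range T, G.integratedRisk (G.iterEstimator η maxO minO t) P) / T := by
    rw [integratedRiskRnd, hfun, integral_div, integral_finsetSum _ fun t _ => hI t]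
    rfl
  have hlow : A - α' ≤ G.integratedRiskRnd (G.rndEstimator η maxO minO T) P := by
    rw [hval, le_div_iff₀ hT0]
    calc (A - α') * T = ∑ _t ∈ Finset.range T, (A - α') := by
          rw [Finset.sum_const, Finset.card_range, nsmul_eq_mul, mul_comm]
      _ ≤ _ := Finset.sum_le_sum fun t _ => hinf _
  have hupp : G.integratedRiskRnd (G.rndEstimator η maxO minO T) P ≤ A + ρ := by
    have := integral_mono hIrnd (integrable_const (A + ρ)) hsup
    simpa [integratedRiskRnd] using this
  refine ⟨isProbabilityMeasure_inv_smul_sum hT _, ‹_›, ⟨A + ρ, ?_⟩, ?_, ⟨A - α', ?_⟩, ?_⟩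
  · rintro _ ⟨θ, rfl⟩
    exact hsup θ
  · linarith [ciSup_le hsup]
  · rintro _ ⟨e, rfl⟩
    exact hinf e
  · linarith [le_ciInf hinf]

end Iterates

lemma IsApproxMixedNE.mono {ε ε' : ℝ} {μ : Measure G.Estimator} {P : Measure G.Θ}
    (h : G.IsApproxMixedNE ε μ P) (hε : ε ≤ ε') : G.IsApproxMixedNE ε' μ P where
  __ := h
  sup_sub_le := by linarith [h.sup_sub_le]
  le_inf_add := by linarith [h.le_inf_add]

end StatisticalGame

theorem theorem1 :
    ∃ C : ℝ, 0 < C ∧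
      ∀ (d n : ℕ) (𝒳 : Type u) [MeasurableSpace 𝒳] (G : StatisticalGame d n 𝒳)
        (_ : IsCompact G.Θ) (_ : G.HasFiniteRisk)
        (L : ℝ) (_ : 0 ≤ L) (_ : G.RiskLipschitz L)
        (α β α' : ℝ) (_ : 0 ≤ α) (_ : 0 ≤ β) (_ : 0 ≤ α')
        (maxO : List G.Estimator → (Fin d → ℝ) → G.Θ) (_ : G.IsMaxOracle α β maxO)
        (minO : Measure G.Θ → G.Estimator) (_ : G.IsMinOracle α' minO)
        (η : ℝ) (_ : 0 < η) (T : ℕ) (_ : 1 ≤ T),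
        G.IsApproxMixedNE
          (C * (η * d ^ 2 * Metric.diam G.Θ * L ^ 2
            + d * (β * T + Metric.diam G.Θ) / (η * T) + α + α'))
          (G.rndEstimator η maxO minO T) (G.avgPrior η maxO minO T) := by
  -- The largest coefficient is that of `d * β / η`: 2 from the leader's `T + 1 ≤ 2 * T` oracle
  -- errors and 5 from stability.
  refine ⟨7, by norm_num, ?_⟩
  intro d n 𝒳 _ G hΘ _ L hL hG α β α' hα hβ hα' maxO hmax minO hmin η hη T hT
  have hT1 : (1 : ℝ) ≤ T := by exact_mod_cast hT
  have hT0 : (0 : ℝ) < T := by linarith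
  have hγ : 0 ≤ α + β * (d / η) := by positivity
  refine (StatisticalGame.isApproxMixedNE_of_regret_le
    (ρ := Metric.diam G.Θ * (d / η) / T + 2 * (α + β * (d / η)) +
      (4 * (η * d ^ 2 * Metric.diam G.Θ * L ^ 2) + 3 * α + 5 * (d * β / η)))
    hmax hη hΘ hG hmin hT fun θ => ?_).mono ?_
  · have h := hmax.sum_risk_le (minO := minO) hη hΘ hL hG hα hβ T θ
    rw [div_le_iff₀ hT0]
    refine h.trans ?_
    have h2 : (T + 1) * (α + β * (d / η)) ≤ 2 * (α + β * (d / η)) * T := by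
      nlinarith [mul_le_mul_of_nonneg_right hT1 hγ]
    rw [add_mul _ _ (T : ℝ), div_mul_cancel₀ _ hT0.ne']
    have h3 := div_mul_cancel₀ (Metric.diam G.Θ * (d / η)) hT0.ne'
    linarith
  · have e : d * (β * T + Metric.diam G.Θ) / (η * T) =
        d * β / η + Metric.diam G.Θ * (d / η) / T := by
      field_simp
    have e' : β * (d / η) = d * β / η := by ring
    have h1 : 0 ≤ η * d ^ 2 * Metric.diam G.Θ * L ^ 2 := by positivity
    have h2 : 0 ≤ Metric.diam G.Θ * (d / η) / T := by positivity
    rw [e, e']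
    linarith
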